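/- **Setting.** Consider full conjunctive queries without self-joins $q(x_1,\dots,x_k)=S_1(\bar x_1),\dots,S_\ell(\bar x_\ell)$, where $S_j$ has arity $a_j$. Every variable occurs in the body, no variable is repeated within an atom, and no relation is unary (all $a_j\ge 2$). The hypergraph of $q$ has the variables as nodes and the sets $\mathrm{vars}(S_j)$ as hyperedges; $q$ is connected if its hypergraph is (nonempty and) connected. The fractional covering number is $$\tau^*=\min\Big\{\sum_{i=1}^k v_i \;:\; v_i\ge 0,\ \sum_{i:\,x_i\in \mathrm{vars}(S_j)} v_i\ge 1\ \text{ for all } j\Big\}.$$ A matching database over $[n]$ assigns to each $S_j$ an $a_j$-dimensional matching: a set of exactly $n$ tuples in $[n]^{a_j}$ such that each column contains each value exactly once. The answer $q(I)$ is the set of all $\mathbf a\in[n]^k$ whose projection to $\bar x_j$ lies in $S_j$ for every $j$. The size in bits of such a database is $N=\sum_j (a_j-1)\log_2(n!)$. A deterministic one-round algorithm on $p$ servers (workers), for inputs over $[n]$, works as follows. Each relation $S_j$ is stored on a separate input server, which sends to each worker a bit string that depends only on $S_j$; then each worker reports a set of tuples in $[n]^k$ that depends only on the messages it received. It is an MPC$(\varepsilon)$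 algorithm with constant $c$ if on every matching database each worker receives at most $c\,N/p^{1-\varepsilon}$ bits in total. Let $A(I)$ be the set of tuples reported by all workers on input $I$; only answers may be reported, that is, $A(I)\subseteq q(I)$ for every matching database $I$. **Theorem.** Let $q$ be a connected query as above and let $c>0$. There is a constant $C>0$, depending only on $q$ and $c$, such that for every real $\varepsilon$ with $0\le\varepsilon<1-1/\tau^*$, all integers $n\ge 2$ and $p\ge 1$, and every deterministic one-round MPC$(\varepsilon)$ algorithm with constant $c$ on $p$ servers, for inputs over $[n]$ and reporting only answers, $$\mathbf E\big[|A(I)|\big]\ \le\ C\cdot\frac{\mathbf E\big[|q(I)|\big]}{p^{\tau^*(1-\varepsilon)-1}},$$ where $I$ is a uniformly random matching database over $[n]$. -/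

import Mathlib

open scoped BigOperators

noncomputable section

namespace MPC

/-- A full conjunctive query without self-joins
`q(x_1, …, x_k) = S_1(x̄_1), …, S_ℓ(x̄_ℓ)` with `k = numVars`, `ℓ = numAtoms`. The atoms are indexed
by the relation symbols, so no relation symbol is used twice, and the head consists of all variables
of the body. -/
structure ConjunctiveQuery where
  /-- the number `k` of variables -/
  numVars : ℕ
  /-- the number `ℓ` of atoms -/
  numAtoms : ℕ
  /-- the arity `a_j` of the relation symbol `S_j` -/
  arity : Fin numAtoms → ℕ
  /-- `var j t` is the variable at position `t` of the atom `S_j` -/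
  var : (j : Fin numAtoms) → Fin (arity j) → Fin numVars
  /-- every (head) variable occurs in the body -/
  occurs : ∀ i, ∃ j t, var j t = i

namespace ConjunctiveQuery

variable (q : ConjunctiveQuery)

/-- `vars(S_j)`: the set of variables of the atom `S_j`, a hyperedge of the query hypergraph. -/
def atomVars (j : Fin q.numAtoms) : Finset (Fin q.numVars) :=
  Finset.univ.image (q.var j)

/-- No atom contains the same variable twice, so that the arity of an atom is the size of its
hyperedge. -/
def NoRepeatedVariables : Prop :=
  ∀ j, Function.Injective (q.var j)

/-- The graph on the variables in which two distinct variables are adjacent when they occur in a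
common atom. -/
def primalGraph : SimpleGraph (Fin q.numVars) where
  Adj x y := x ≠ y ∧ ∃ j, x ∈ q.atomVars j ∧ y ∈ q.atomVars j
  symm := ⟨fun _ _ h => ⟨h.1.symm, h.2.imp fun _ hj => ⟨hj.2, hj.1⟩⟩⟩
  loopless := ⟨fun _ h => h.1 rfl⟩

/-- The query hypergraph is (nonempty and) connected: any two variables are joined by a path of
consecutively co-occurring variables. -/
def IsConnected : Prop :=
  q.primalGraph.Connected

/-- Fractional vertex covers: the feasible solutions of the vertex covering LP. -/
def IsFractionalVertexCover (v : Fin q.numVars → ℝ) : Prop :=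
  (∀ i, 0 ≤ v i) ∧ ∀ j, 1 ≤ ∑ i ∈ q.atomVars j, v i

/-- The fractional covering number `τ*(q)`: the optimal value of the vertex covering LP. -/
def tauStar : ℝ :=
  sInf {s : ℝ | ∃ v, q.IsFractionalVertexCover v ∧ s = ∑ i, v i}

end ConjunctiveQuery

/-- An `a`-dimensional matching over the domain `[n]`: a relation with exactly `n` tuples each of
whose columns contains every value exactly once. -/
def IsMatching {n a : ℕ} (R : Finset (Fin a → Fin n)) : Prop :=
  R.card = n ∧ ∀ (t : Fin a) (v : Fin n), ∃! x : Fin a → Fin n, x ∈ R ∧ x t = v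

/-- The finite type of `a`-dimensional matchings over `[n]`. -/
abbrev Matching (n a : ℕ) : Type :=
  {R : Finset (Fin a → Fin n) // IsMatching R}

instance instFintypeMatching (n a : ℕ) : Fintype (Matching n a) :=
  Fintype.ofFinite _

/-- A matching database over `[n]`: an `a_j`-dimensional matching for every symbol `S_j`. -/
abbrev MatchingDatabase (q : ConjunctiveQuery) (n : ℕ) : Type :=
  (j : Fin q.numAtoms) → Matching n (q.arity j)

/-- The expectation of `f(I)` for a uniformly random matching database `I` over `[n]`. -/
def expectation (q : ConjunctiveQuery) (n : ℕ) (f : MatchingDatabase q n → ℝ) : ℝ :=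
  (∑ I, f I) / (Fintype.card (MatchingDatabase q n) : ℝ)

/-- The answer `q(I)`: all assignments `x` of values to the variables whose projection to each atom
`S_j` is a tuple of the relation `S_j`. -/
def answers (q : ConjunctiveQuery) {n : ℕ} (I : MatchingDatabase q n) :
    Finset (Fin q.numVars → Fin n) :=
  {x | ∀ j, (fun t => x (q.var j t)) ∈ (I j).1}

/-- The size `N` in bits of a matching database over `[n]`:
`N = ∑_j (a_j - 1) log₂(n!)`, where `(n!) ^ (a_j - 1)` is the number of `a_j`-dimensional
matchings. -/
def inputBits (q : ConjunctiveQuery) (n : ℕ) : ℝ :=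
  ∑ j, ((q.arity j : ℝ) - 1) * Real.logb 2 (n.factorial : ℝ)

/-- A deterministic algorithm with one communication round on `p` workers, for inputs over `[n]`.
Each relation `S_j` is stored on its own input server, which sends to each worker `u` an arbitrary
bit string that depends only on `S_j`. Each worker then reports a set of tuples that depends
only on the messages that it received. Local computation is unlimited. -/
structure OneRoundAlgorithm (q : ConjunctiveQuery) (n p : ℕ) where
  /-- the message from the input server of `S_j` to the worker `u` -/
  message : (j : Fin q.numAtoms) → Fin p → Matching n (q.arity j) → List Bool
  /-- the tuples reported by worker `u`, given the messages received from the input servers -/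
  output : Fin p → (Fin q.numAtoms → List Bool) → Finset (Fin q.numVars → Fin n)

namespace OneRoundAlgorithm

variable {q : ConjunctiveQuery} {n p : ℕ} (A : OneRoundAlgorithm q n p)

/-- The messages that worker `u` receives on input `I`. -/
def received (u : Fin p) (I : MatchingDatabase q n) : Fin q.numAtoms → List Bool :=
  fun j => A.message j u (I j)

/-- The communication restriction of the MPC(ε) model with constant `c`: on every input each worker
receives at most `c · N / p ^ (1 - ε)` bits in total. -/
def ObeysMPC (c ε : ℝ) : Prop :=
  ∀ (I : MatchingDatabase q n) (u : Fin p),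
    ((∑ j, (A.received u I j).length : ℕ) : ℝ) ≤ c * inputBits q n / (p : ℝ) ^ (1 - ε)

/-- The set of all tuples reported by the workers on input `I`. -/
def reported (I : MatchingDatabase q n) : Finset (Fin q.numVars → Fin n) :=
  Finset.univ.biUnion fun u => A.output u (A.received u I)

/-- On every input, only answers to the query are reported (not necessarily all of them). -/
def IsSound : Prop :=
  ∀ I : MatchingDatabase q n, A.reported I ⊆ answers q I

end OneRoundAlgorithm

end MPC

end

open scoped BigOperators

namespace MPC

/-! Call a tuple known to a worker if it lies in every matching consistent with the message about
its relation. Relations can be changed independently, so a sound worker reports `x` only if every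
projection of `x` is known. The expected output of one worker is thus at most the sum over `x` of
the product over `j` of the probabilities that the projection of `x` to `S_j` is known.

Divide each factor by the probability that the tuple belongs to `S_j`. This leaves a density in [0,
1] and splits off exactly the expected number of answers. For a fractional edge packing `u`, each
density is at most its `u j`-th power, and Finner's inequality (`finner`) bounds the average of the
product by the product of the `u j`-th powers of the averages. An entropy argument
(`sum_card_known_mul_log_le`) shows that `B` bits reveal on average a fraction O(B / log n!) of a
relation, which is O(p^(-(1-ε))) for the allowed `B`. By LP duality (`exists_edgePacking`) the
packing can have total weight τ*, so each worker finds a fraction O(p^(-τ*(1-ε))) of the expected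
answers; summing over `p` workers gives the bound. -/

/-! ### Hölder and Finner inequalities for averages -/

/-- Weighted AM–GM with total weight at most one. -/
lemma prod_rpow_le_add_one_sub {J : Type*} (s : Finset J) (u r : J → ℝ)
    (hu : ∀ j ∈ s, 0 ≤ u j) (hr : ∀ j ∈ s, 0 ≤ r j) (hsum : ∑ j ∈ s, u j ≤ 1) :
    ∏ j ∈ s, r j ^ u j ≤ ∑ j ∈ s, u j * r j + (1 - ∑ j ∈ s, u j) := by
  -- The extra index `none` carries the missing weight, with value 1.
  have h := Real.geom_mean_le_arith_mean_weighted (Finset.insertNone s)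
    (fun o => o.elim (1 - ∑ j ∈ s, u j) u) (fun o => o.elim 1 r) ?_ ?_ ?_
  · simp only [Finset.prod_insertNone, Finset.sum_insertNone, Option.elim, Real.one_rpow, one_mul,
      mul_one] at h
    linarith
  · intro o ho
    cases o with
    | none => simpa using hsum
    | some j => exact hu j (by simpa using ho)
  · simp [Finset.sum_insertNone]
  · intro o ho
    cases o with
    | none => simp
    | some j => exact hr j (by simpa using ho)

/-- Hölder's inequality for averages over a finite type, with total weight at most one. -/
lemma average_prod_rpow_le {J α : Type*} [Fintype α] [Nonempty α] (s : Finset J) (u : J → ℝ)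
    (g : J → α → ℝ) (hu : ∀ j ∈ s, 0 ≤ u j) (hg : ∀ j ∈ s, ∀ b, 0 ≤ g j b)
    (hsum : ∑ j ∈ s, u j ≤ 1) :
    (∑ b, ∏ j ∈ s, g j b ^ u j) / (Fintype.card α : ℝ) ≤
      ∏ j ∈ s, ((∑ b, g j b) / (Fintype.card α : ℝ)) ^ u j := by
  have hcard : (0 : ℝ) < Fintype.card α := by exact_mod_cast Fintype.card_pos
  set G : J → ℝ := fun j => (∑ b, g j b) / (Fintype.card α : ℝ) with hGdef
  have hG : ∀ j ∈ s, 0 ≤ G j := fun j hj =>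
    div_nonneg (Finset.sum_nonneg fun b _ => hg j hj b) hcard.le
  have hP : 0 ≤ ∏ j ∈ s, G j ^ u j :=
    Finset.prod_nonneg fun j hj => Real.rpow_nonneg (hG j hj) _
  by_cases hz : ∃ j ∈ s, G j = 0 ∧ u j ≠ 0
  · obtain ⟨j, hj, hGj, huj⟩ := hz
    have hz : ∀ b, g j b = 0 := by
      have : ∑ b, g j b = 0 := by
        rcases div_eq_zero_iff.1 hGj with h | h
        · exact h
        · exact absurd h hcard.ne'
      intro b
      exact (Finset.sum_eq_zero_iff_of_nonneg fun b _ => hg j hj b).1 this b (Finset.mem_univ b)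
    have : ∑ b, ∏ j ∈ s, g j b ^ u j = 0 := by
      refine Finset.sum_eq_zero fun b _ => Finset.prod_eq_zero hj ?_
      rw [hz b, Real.zero_rpow huj]
    rw [this, zero_div]
    exact hP
  · push Not at hz
    -- Normalise each function by its average, then apply AM–GM pointwise. If `G j = 0`, then `u j =
    -- 0` and all powers are 1.
    have hfac : ∀ j ∈ s, ∀ b, g j b ^ u j = G j ^ u j * (g j b / G j) ^ u j := by
      intro j hj b
      by_cases h0 : G j = 0
      · simp [hz j hj h0]
      · rw [← Real.mul_rpow (hG j hj) (div_nonneg (hg j hj b) (hG j hj)), mul_div_cancel₀ _ h0]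
    have hpt : ∀ b, ∏ j ∈ s, g j b ^ u j ≤
        (∏ j ∈ s, G j ^ u j) * (∑ j ∈ s, u j * (g j b / G j) + (1 - ∑ j ∈ s, u j)) := by
      intro b
      rw [Finset.prod_congr rfl fun j hj => hfac j hj b, Finset.prod_mul_distrib]
      exact mul_le_mul_of_nonneg_left (prod_rpow_le_add_one_sub s u _ hu
        (fun j hj => div_nonneg (hg j hj b) (hG j hj)) hsum) hP
    rw [div_le_iff₀ hcard]
    refine (Finset.sum_le_sum fun b _ => hpt b).trans ?_
    rw [← Finset.mul_sum]
    refine mul_le_mul_of_nonneg_left ?_ hP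
    rw [Finset.sum_add_distrib, Finset.sum_comm]
    have h1 : ∀ j ∈ s, ∑ b, u j * (g j b / G j) ≤ u j * Fintype.card α := by
      intro j hj
      rw [← Finset.mul_sum]
      refine mul_le_mul_of_nonneg_left ?_ (hu j hj)
      rw [← Finset.sum_div]
      refine div_le_of_le_mul₀ (hG j hj) hcard.le ?_
      rw [hGdef]
      simp only
      rw [mul_div_cancel₀ _ hcard.ne']
    have h2 := Finset.sum_le_sum h1
    rw [← Finset.sum_mul] at h2
    simp only [Finset.sum_const, Finset.card_univ, nsmul_eq_mul]
    nlinarith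

/-- Finner's inequality for averages over a finite cube: `g j` depends only on the coordinates
`i` with `e j i`, and `u` is a fractional packing of these sets of coordinates. -/
lemma finner {J α : Type*} [Fintype J] [Fintype α] [Nonempty α] (u : J → ℝ) (hu : ∀ j, 0 ≤ u j)
    (k : ℕ) (e : J → Finset (Fin k)) (g : J → (Fin k → α) → ℝ) (hg : ∀ j x, 0 ≤ g j x)
    (hdep : ∀ j x y, (∀ i ∈ e j, x i = y i) → g j x = g j y)
    (hsum : ∀ i, ∑ j with i ∈ e j, u j ≤ 1) :
    (∑ x, ∏ j, g j x ^ u j) / (Fintype.card α : ℝ) ^ k ≤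
      ∏ j, ((∑ x, g j x) / (Fintype.card α : ℝ) ^ k) ^ u j := by
  classical
  induction k with
  | zero => simp
  | succ k ih =>
    have hcard : (0 : ℝ) < Fintype.card α := by exact_mod_cast Fintype.card_pos
    have hsplit : ∀ F : (Fin (k + 1) → α) → ℝ,
        (∑ x, F x) / (Fintype.card α : ℝ) ^ (k + 1) =
          (∑ y : Fin k → α, (∑ b, F (Fin.cons b y)) / (Fintype.card α : ℝ)) /
            (Fintype.card α : ℝ) ^ k := by
      intro F
      rw [← Finset.sum_div, div_div, ← pow_succ', Finset.sum_comm, ← Fintype.sum_prod_type',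
        ← Equiv.sum_comp (Fin.consEquiv fun _ => α)]
      rfl
    rw [hsplit]
    simp_rw [hsplit (g _)]
    -- Average out coordinate 0: Hölder handles the functions that depend on it, and the induction
    -- hypothesis applies to the averaged functions.
    refine le_trans ?_ (ih (fun j => Finset.univ.filter fun i => i.succ ∈ e j)
      (fun j y => (∑ b, g j (Fin.cons b y)) / (Fintype.card α : ℝ)) ?_ ?_ ?_)
    · refine div_le_div_of_nonneg_right (Finset.sum_le_sum fun y _ => ?_) (by positivity)
      have hconst : ∀ j, 0 ∉ e j → ∀ b, g j (Fin.cons b y) =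
          (∑ b, g j (Fin.cons b y)) / (Fintype.card α : ℝ) := by
        intro j hj b
        have : ∀ b', g j (Fin.cons b' y) = g j (Fin.cons b y) := by
          intro b'
          refine hdep j _ _ fun i hi => ?_
          cases i using Fin.cases with
          | zero => exact absurd hi hj
          | succ i => simp
        simp only [this]
        simp [hcard.ne']
      have hL : ∀ b, ∏ j, g j (Fin.cons b y) ^ u j =
          (∏ j with 0 ∈ e j, g j (Fin.cons b y) ^ u j) *
          ∏ j with 0 ∉ e j, ((∑ b, g j (Fin.cons b y)) / (Fintype.card α : ℝ)) ^ u j := by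
        intro b
        rw [← Finset.prod_filter_mul_prod_filter_not Finset.univ (fun j => 0 ∈ e j)]
        congr 1
        refine Finset.prod_congr rfl fun j hj => ?_
        rw [← hconst j (Finset.mem_filter.1 hj).2 b]
      rw [← Finset.prod_filter_mul_prod_filter_not Finset.univ (fun j => 0 ∈ e j)
        (fun j => ((∑ b, g j (Fin.cons b y)) / (Fintype.card α : ℝ)) ^ u j)]
      simp_rw [hL]
      rw [← Finset.sum_mul, mul_div_right_comm]
      refine mul_le_mul_of_nonneg_right (average_prod_rpow_le _ u _ (fun j _ => hu j)
        (fun j _ b => hg j _) (hsum 0)) (Finset.prod_nonneg fun j _ => Real.rpow_nonneg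
          (div_nonneg (Finset.sum_nonneg fun b _ => hg j _) hcard.le) _)
    · exact fun j y => div_nonneg (Finset.sum_nonneg fun b _ => hg j _) hcard.le
    · intro j x y hxy
      congr 1
      refine Finset.sum_congr rfl fun b _ => hdep j _ _ fun i hi => ?_
      cases i using Fin.cases with
      | zero => simp
      | succ i => simpa using hxy i (by simpa using hi)
    · intro i
      simpa using hsum i.succ

/-- Summing over a cube a function of the coordinates selected by an injection. -/
lemma average_comp_injective {α : Type*} [Fintype α] [Nonempty α] {k a : ℕ} (ι : Fin a → Fin k)
    (hι : Function.Injective ι) (h : (Fin a → α) → ℝ) :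
    (∑ x : Fin k → α, h (fun t => x (ι t))) / (Fintype.card α : ℝ) ^ k =
      (∑ y, h y) / (Fintype.card α : ℝ) ^ a := by
  classical
  have hcard : (0 : ℝ) < Fintype.card α := by exact_mod_cast Fintype.card_pos
  -- All fibres of the restriction map have the same size `c`; the case `h = 1` then determines `c`.
  obtain ⟨c, hc⟩ : ∃ c : ℝ, ∀ h : (Fin a → α) → ℝ,
      ∑ x : Fin k → α, h (fun t => x (ι t)) = c * ∑ y, h y := by
    refine ⟨Fintype.card ({i // i ∉ Set.range ι} → α), fun h => ?_⟩
    let E : (Fin k → α) ≃ (Fin a → α) × ({i // i ∉ Set.range ι} → α) :=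
      (Equiv.piEquivPiSubtypeProd (fun i => i ∈ Set.range ι) (fun _ => α)).trans
        (Equiv.prodCongr ((Equiv.ofInjective ι hι).symm.arrowCongr (Equiv.refl α))
          (Equiv.refl _))
    have hE : ∑ x : Fin k → α, h (fun t => x (ι t)) = ∑ z : (Fin a → α) × _, h z.1 :=
      Fintype.sum_equiv E _ (fun z => h z.1) fun x => rfl
    rw [hE, Fintype.sum_prod_type, Finset.mul_sum]
    simp
  have h1 := hc fun _ => 1
  simp only [Finset.sum_const, Finset.card_univ, nsmul_eq_mul, mul_one, Fintype.card_pi,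
    Finset.prod_const, Fintype.card_fin, Nat.cast_pow] at h1
  rw [hc h, h1]
  have : c ≠ 0 := by
    rintro rfl
    rw [zero_mul] at h1
    exact (pow_pos hcard k).ne' h1
  field_simp

/-! ### Linear programming duality -/

/-- Strong linear programming duality for the fractional covering number: there is a fractional
edge packing of total weight `τ*`. -/
lemma exists_edgePacking (q : ConjunctiveQuery) [Nonempty (Fin q.numAtoms)] (hτ : 0 < q.tauStar) :
    ∃ u : Fin q.numAtoms → ℝ, (∀ j, 0 ≤ u j) ∧ (∀ i, ∑ j with i ∈ q.atomVars j, u j ≤ 1) ∧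
      ∑ j, u j = q.tauStar := by
  classical
  let Φ : (Fin q.numAtoms → ℝ) →ₗ[ℝ] (Fin q.numVars → ℝ) :=
    { toFun := fun u i => ∑ j with i ∈ q.atomVars j, u j
      map_add' := fun u v => by ext i; simp [Finset.sum_add_distrib]
      map_smul' := fun r u => by ext i; simp [Finset.mul_sum] }
  set τ := q.tauStar with hτdef
  -- A packing of weight `τ` is `τ` times a point of the simplex whose load at every variable is at
  -- most `1 / τ`. If no such point exists, a hyperplane separating loads from bounds yields a
  -- vertex cover cheaper than `τ`.
  let s : Set (Fin q.numVars → ℝ) := {y | ∀ i, y i ≤ 1 / τ}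
  let t : Set (Fin q.numVars → ℝ) := Φ '' stdSimplex ℝ (Fin q.numAtoms)
  by_cases hdisj : Disjoint s t
  · exfalso
    have hs : Convex ℝ s := by
      have : s = Set.Iic (fun _ => 1 / τ) := by ext y; rfl
      rw [this]; exact convex_Iic _
    have hs' : IsClosed s := by
      have : s = Set.Iic (fun _ => 1 / τ) := by ext y; rfl
      rw [this]; exact isClosed_Iic
    have ht : Convex ℝ t := (convex_stdSimplex ℝ _).linear_image Φ
    have ht' : IsCompact t :=
      (isCompact_stdSimplex ℝ _).image Φ.continuous_of_finiteDimensional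
    obtain ⟨f, a, b, hfa, hab, hfb⟩ := geometric_hahn_banach_closed_compact hs hs' ht ht' hdisj
    let v : Fin q.numVars → ℝ := fun i => f (Pi.single i 1)
    have hf : ∀ y, f y = ∑ i, y i * v i := by
      intro y
      conv_lhs => rw [← Finset.univ_sum_single y]
      rw [map_sum]
      refine Finset.sum_congr rfl fun i _ => ?_
      have : (Pi.single i (y i) : Fin q.numVars → ℝ) = y i • Pi.single i 1 := by
        rw [← Pi.single_smul]; simp
      rw [this, map_smul, smul_eq_mul]
    -- `s` is unbounded below in each coordinate, while `f` is bounded above on it.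
    have hv : ∀ i, 0 ≤ v i := by
      intro i
      by_contra hneg
      push Not at hneg
      obtain ⟨m, hm⟩ := exists_nat_gt (a / (-v i))
      have h0 := hfa (-(m : ℝ) • Pi.single i 1) (by
        intro i'
        have h1 : (0 : ℝ) ≤ (Pi.single i (1 : ℝ) : Fin q.numVars → ℝ) i' := by
          by_cases h : i' = i
          · subst h; simp
          · simp [h]
        have h2 : (0 : ℝ) ≤ 1 / τ := by positivity
        simp only [Pi.smul_apply, smul_eq_mul]
        nlinarith [(Nat.cast_nonneg m : (0 : ℝ) ≤ m)])
      rw [map_smul, smul_eq_mul] at h0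
      rw [div_lt_iff₀ (by linarith)] at hm
      change -(m : ℝ) * v i < a at h0
      linarith
    have ha : (∑ i, v i) / τ < a := by
      have := hfa (fun _ => 1 / τ) (fun i => le_rfl)
      rw [hf, ← Finset.mul_sum] at this
      rwa [div_eq_inv_mul, ← one_div]
    have hcov : ∀ j, b < ∑ i ∈ q.atomVars j, v i := by
      intro j
      have := hfb (Φ (Pi.single j 1)) ⟨_, single_mem_stdSimplex ℝ j, rfl⟩
      rw [hf] at this
      refine this.trans_eq ?_
      rw [← Finset.sum_filter_add_sum_filter_not Finset.univ (fun i => i ∈ q.atomVars j)]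
      have hΦ : ∀ i, Φ (Pi.single j 1) i = if i ∈ q.atomVars j then 1 else 0 := by
        intro i
        change ∑ j' with i ∈ q.atomVars j', (Pi.single j (1 : ℝ) : _ → ℝ) j' = _
        simp [Pi.single_apply]
      rw [Finset.sum_congr rfl (g := v) (fun i hi => by
        rw [hΦ, if_pos (Finset.mem_filter.1 hi).2, one_mul]),
        Finset.sum_eq_zero (s := Finset.univ.filter fun i => i ∉ q.atomVars j) (fun i hi => by
        rw [hΦ, if_neg (Finset.mem_filter.1 hi).2, zero_mul]), add_zero]
      congr 1
      ext i; simp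
    have hapos : 0 < a := lt_of_le_of_lt
      (div_nonneg (Finset.sum_nonneg fun i _ => hv i) hτ.le) ha
    have hbpos : 0 < b := hapos.trans hab
    -- Scaled by `1 / b`, the separating functional is a cover, of weight below `τ` because `a < b`.
    have hle : τ ≤ (∑ i, v i) / b := by
      refine csInf_le ⟨0, ?_⟩ ⟨fun i => v i / b, ⟨fun i => div_nonneg (hv i) hbpos.le,
        fun j => ?_⟩, Finset.sum_div _ _ _⟩
      · rintro _ ⟨w, hw, rfl⟩
        exact Finset.sum_nonneg fun i _ => hw.1 i
      · rw [← Finset.sum_div, le_div_iff₀ hbpos, one_mul]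
        exact (hcov j).le
    rw [le_div_iff₀ hbpos] at hle
    rw [div_lt_iff₀ hτ] at ha
    nlinarith
  · rw [Set.not_disjoint_iff] at hdisj
    obtain ⟨_, hy, w, hw, rfl⟩ := hdisj
    refine ⟨fun j => τ * w j, fun j => mul_nonneg hτ.le (hw.1 j), fun i => ?_, ?_⟩
    · rw [← Finset.mul_sum]
      have : ∑ j with i ∈ q.atomVars j, w j ≤ 1 / τ := hy i
      rw [le_div_iff₀ hτ] at this
      linarith
    · rw [← Finset.mul_sum, hw.2, mul_one]

lemma one_le_tauStar (q : ConjunctiveQuery) [Nonempty (Fin q.numAtoms)]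
    (harity : ∀ j, 1 ≤ q.arity j) : 1 ≤ q.tauStar := by
  refine le_csInf ⟨_, fun _ => 1, ⟨fun _ => zero_le_one, fun j => ?_⟩, rfl⟩ ?_
  · have : 1 ≤ (q.atomVars j).card :=
      Finset.card_pos.2 ⟨q.var j ⟨0, harity j⟩, Finset.mem_image_of_mem _ (Finset.mem_univ _)⟩
    simpa using this
  · rintro _ ⟨v, hv, rfl⟩
    obtain ⟨j⟩ := ‹Nonempty (Fin q.numAtoms)›
    exact (hv.2 j).trans
      (Finset.sum_le_sum_of_subset_of_nonneg (Finset.subset_univ _) fun i _ _ => hv.1 i)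

end MPC

namespace MPC

/-! ### Matchings as tuples of permutations -/

section Matchings

variable {n a b : ℕ}

lemma IsMatching.eq_of_apply_eq {R : Finset (Fin a → Fin n)} (hR : IsMatching R)
    {x y : Fin a → Fin n} (hx : x ∈ R) (hy : y ∈ R) {t : Fin a} (h : x t = y t) : x = y :=
  (hR.2 t (y t)).unique ⟨hx, h⟩ ⟨hy, rfl⟩

/-- The tuple with first entry `v` and further entries `σ t v`. -/
def permTuple (σ : Fin b → Equiv.Perm (Fin n)) (v : Fin n) : Fin (b + 1) → Fin n :=
  Fin.cons v fun t => σ t v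

lemma permTuple_injective (σ : Fin b → Equiv.Perm (Fin n)) :
    Function.Injective (permTuple σ) := fun v w h => by
  simpa [permTuple] using congrFun h 0

/-- The matching whose columns are the images of the first column under given permutations. -/
def matchingOfPerms (σ : Fin b → Equiv.Perm (Fin n)) : Matching n (b + 1) :=
  ⟨Finset.univ.image (permTuple σ), by
    refine ⟨by rw [Finset.card_image_of_injective _ (permTuple_injective σ)]; simp, fun t v => ?_⟩
    cases t using Fin.cases with
    | zero =>
      refine ⟨permTuple σ v, ⟨by simp, rfl⟩, ?_⟩
      rintro x ⟨hx, rfl⟩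
      obtain ⟨w, -, rfl⟩ := Finset.mem_image.1 hx
      rfl
    | succ t =>
      refine ⟨permTuple σ ((σ t).symm v), ⟨by simp, by simp [permTuple]⟩, ?_⟩
      rintro x ⟨hx, rfl⟩
      obtain ⟨w, -, rfl⟩ := Finset.mem_image.1 hx
      simp [permTuple]⟩

lemma mem_matchingOfPerms {σ : Fin b → Equiv.Perm (Fin n)} {x : Fin (b + 1) → Fin n} :
    x ∈ (matchingOfPerms σ).1 ↔ ∀ t, σ t (x 0) = x t.succ := by
  constructor
  · intro hx t
    obtain ⟨w, -, rfl⟩ := Finset.mem_image.1 hx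
    rfl
  · intro h
    refine Finset.mem_image.2 ⟨x 0, Finset.mem_univ _, ?_⟩
    ext t
    cases t using Fin.cases with
    | zero => rfl
    | succ t => simp [permTuple, h t]

/-- Column 0 lists every value once, so each further column is a permutation of it. -/
lemma matchingOfPerms_bijective :
    Function.Bijective (matchingOfPerms : (Fin b → Equiv.Perm (Fin n)) → Matching n (b + 1)) := by
  constructor
  · intro σ τ h
    ext t v : 2
    have hv : permTuple σ v ∈ (matchingOfPerms τ).1 := by
      rw [← h]; exact Finset.mem_image_of_mem _ (Finset.mem_univ v)
    exact (mem_matchingOfPerms.1 hv t).symm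
  · rintro ⟨R, hR⟩
    choose f hf hf' using fun v => (hR.2 0 v).exists
    have hinj : ∀ t : Fin b, Function.Injective fun v => f v t.succ := by
      intro t v w h
      have := hR.eq_of_apply_eq (hf v) (hf w) h
      rw [← hf' v, this, hf' w]
    refine ⟨fun t => Equiv.ofBijective _ (Finite.injective_iff_bijective.1 (hinj t)), ?_⟩
    ext x
    rw [mem_matchingOfPerms]
    constructor
    · intro h
      have : x = f (x 0) := by
        ext t
        cases t using Fin.cases with
        | zero => rw [hf']
        | succ t => rw [← h t]; rfl
      rw [this]
      exact hf _
    · intro hx t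
      have : f (x 0) = x := hR.eq_of_apply_eq (hf _) hx (hf' _)
      exact congrFun this _

/-- Matchings of arity `b + 1` correspond to `b`-tuples of permutations. -/
noncomputable def permsEquivMatching (n b : ℕ) : (Fin b → Equiv.Perm (Fin n)) ≃ Matching n (b + 1) :=
  Equiv.ofBijective _ matchingOfPerms_bijective

lemma card_matching (n b : ℕ) : Fintype.card (Matching n (b + 1)) = n.factorial ^ b := by
  rw [← Fintype.card_congr (permsEquivMatching n b)]
  simp [Fintype.card_perm]

/-- Composition with a transposition shows that all `n` possible images of `v` are equally frequent.
-/
lemma card_perm_apply_eq (v w : Fin n) :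
    n * (Finset.univ.filter fun σ : Equiv.Perm (Fin n) => σ v = w).card = n.factorial := by
  have hc : ∀ w', (Finset.univ.filter fun σ : Equiv.Perm (Fin n) => σ v = w').card =
      (Finset.univ.filter fun σ : Equiv.Perm (Fin n) => σ v = w).card := by
    intro w'
    refine Finset.card_equiv (Equiv.mulLeft (Equiv.swap w w')) fun σ => ?_
    simp [Equiv.swap_apply_eq_iff]
  have := Finset.card_eq_sum_card_fiberwise (s := (Finset.univ : Finset (Equiv.Perm (Fin n))))
    (t := Finset.univ) (f := fun σ => σ v) (by simp)
  rw [Finset.sum_congr rfl fun w' _ => hc w'] at this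
  simpa [Fintype.card_perm] using this.symm

/-- A fixed tuple lies in a uniformly random matching of arity `b + 1` with probability
`n ^ (-b)`. -/
lemma card_matching_mem (x : Fin (b + 1) → Fin n) :
    n ^ b * (Finset.univ.filter fun S : Matching n (b + 1) => x ∈ S.1).card =
      Fintype.card (Matching n (b + 1)) := by
  classical
  have h : (Finset.univ.filter fun S : Matching n (b + 1) => x ∈ S.1).card =
      (Fintype.piFinset fun t : Fin b =>
        Finset.univ.filter fun σ : Equiv.Perm (Fin n) => σ (x 0) = x t.succ).card := by
    refine (Finset.card_equiv (permsEquivMatching n b) fun σ => ?_).symm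
    simp only [Fintype.mem_piFinset, Finset.mem_filter, Finset.mem_univ, true_and]
    exact mem_matchingOfPerms.symm
  rw [h, Fintype.card_piFinset, card_matching]
  have : n ^ b = ∏ _t : Fin b, n := by simp
  rw [this, ← Finset.prod_mul_distrib, Finset.prod_congr rfl fun t _ => card_perm_apply_eq _ _]
  simp

/-- Composition with `σ₀⁻¹` reduces to permutations fixing `D` pointwise, that is, to permutations
of its complement. -/
lemma card_perm_eqOn (D : Finset (Fin n)) (σ₀ : Equiv.Perm (Fin n)) :
    (Finset.univ.filter fun σ : Equiv.Perm (Fin n) => ∀ v ∈ D, σ v = σ₀ v).card =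
      (n - D.card).factorial := by
  classical
  have h1 : (Finset.univ.filter fun σ : Equiv.Perm (Fin n) => ∀ v ∈ D, σ v = σ₀ v).card =
      (Finset.univ.filter fun σ : Equiv.Perm (Fin n) => ∀ v, ¬ v ∉ D → σ v = v).card := by
    refine Finset.card_equiv (Equiv.mulLeft σ₀⁻¹) fun σ => ?_
    simp [Equiv.Perm.inv_def, Equiv.symm_apply_eq]
  rw [h1, ← Fintype.card_subtype,
    ← Fintype.card_congr (Equiv.Perm.subtypeEquivSubtypePerm fun v => v ∉ D), Fintype.card_perm]
  simp [Fintype.card_subtype_compl]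

/-- The number of matchings that contain a given part of a matching. -/
lemma card_matching_superset (S₀ : Matching n (b + 1)) (K : Finset (Fin (b + 1) → Fin n))
    (hK : K ⊆ S₀.1) :
    (Finset.univ.filter fun S : Matching n (b + 1) => K ⊆ S.1).card =
      (n - K.card).factorial ^ b := by
  classical
  obtain ⟨σ₀, rfl⟩ := (permsEquivMatching n b).surjective S₀
  -- Distinct tuples of a matching differ in their first entries, so `K` prescribes each permutation
  -- at exactly `K.card` points.
  have hD : (K.image fun x => x 0).card = K.card := by
    refine Finset.card_image_of_injOn fun x hx y hy h => ?_
    exact (permsEquivMatching n b σ₀).2.eq_of_apply_eq (hK hx) (hK hy) h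
  have h : (Finset.univ.filter fun S : Matching n (b + 1) => K ⊆ S.1).card =
      (Fintype.piFinset fun t : Fin b => Finset.univ.filter fun σ : Equiv.Perm (Fin n) =>
        ∀ v ∈ K.image fun x => x 0, σ v = σ₀ t v).card := by
    refine (Finset.card_equiv (permsEquivMatching n b) fun σ => ?_).symm
    simp only [Fintype.mem_piFinset, Finset.mem_filter, Finset.mem_univ, true_and,
      Finset.forall_mem_image]
    have hσ₀ : ∀ x ∈ K, ∀ t, σ₀ t (x 0) = x t.succ := fun x hx => mem_matchingOfPerms.1 (hK hx)
    constructor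
    · intro hσ x hx
      exact mem_matchingOfPerms.2 fun t => by rw [hσ t hx, hσ₀ x hx t]
    · intro hσ t x hx
      rw [mem_matchingOfPerms.1 (hσ hx) t, hσ₀ x hx t]
  rw [h, Fintype.card_piFinset, Finset.prod_congr rfl fun t _ => card_perm_eqOn _ _, hD]
  simp

/-- For `0 < m`, this says that log m! / m ≤ log n! / n. Hence fixing k of the n tuples of a
matching removes at least the fraction k/n of its entropy. -/
lemma factorial_pow_le_factorial_pow {m n : ℕ} (h : m ≤ n) :
    m.factorial ^ n ≤ n.factorial ^ m := by
  induction n, h using Nat.le_induction with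
  | base => exact le_rfl
  | succ n hmn ih =>
    have h1 : m.factorial ≤ (n + 1) ^ m :=
      (Nat.factorial_le_pow m).trans (Nat.pow_le_pow_left (by omega) m)
    rw [Nat.factorial_succ, mul_pow, pow_succ, mul_comm]
    exact Nat.mul_le_mul h1 ih

/-! ### Messages and known tuples -/

/-- The tuples that are certain to be in the relation, given the message `f S` about it. -/
noncomputable def known {β : Type*} (f : Matching n a → β) (S : Matching n a) : Finset (Fin a → Fin n) :=
  open Classical in Finset.univ.filter fun x => ∀ S', f S' = f S → x ∈ S'.1

lemma mem_known {β : Type*} {f : Matching n a → β} {S : Matching n a} {x : Fin a → Fin n} :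
    x ∈ known f S ↔ ∀ S', f S' = f S → x ∈ S'.1 := by
  simp [known]

lemma known_subset {β : Type*} (f : Matching n a → β) (S : Matching n a) : known f S ⊆ S.1 :=
  fun _ hx => mem_known.1 hx S rfl

/-- If there are few messages, then few tuples are known on average. -/
lemma sum_card_known_mul_log_le {β : Type*} [DecidableEq β] (hn : 0 < n) (f : Matching n (b + 1) → β) :
    (∑ S, ((known f S).card : ℝ)) * (b * Real.log n.factorial) ≤
      n * Fintype.card (Matching n (b + 1)) * Real.log (Finset.univ.image f).card := by
  set M := Fintype.card (Matching n (b + 1)) with hM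
  have hMcard := card_matching n b
  have hMpos : 0 < M := by rw [hM, hMcard]; positivity
  have hMR : (0 : ℝ) < M := by exact_mod_cast hMpos
  have hnR : (0 : ℝ) < n := by exact_mod_cast hn
  have hlogM : Real.log M = b * Real.log n.factorial := by
    rw [hM, hMcard]; push_cast; rw [Real.log_pow]
  have hS₀ : Nonempty (Matching n (b + 1)) := Fintype.card_pos_iff.1 hMpos
  let cls : Matching n (b + 1) → ℕ := fun S => (Finset.univ.filter fun S' => f S' = f S).card
  have hcls_pos : ∀ S, 0 < cls S := fun S => Finset.card_pos.2 ⟨S, by simp⟩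
  -- With k known tuples, the class of `S` has at most (n-k)!^b ≤ M^((n-k)/n) members.
  have hkey : ∀ S, Real.exp ((known f S).card / n * Real.log M) ≤ M / cls S := by
    intro S
    have hk : (known f S).card ≤ n := by
      have := Finset.card_le_card (known_subset f S)
      rwa [S.2.1] at this
    have h1 : cls S ≤ (n - (known f S).card).factorial ^ b := by
      rw [← card_matching_superset S _ (known_subset f S)]
      refine Finset.card_le_card fun S' hS' => ?_
      simp only [Finset.mem_filter, Finset.mem_univ, true_and] at hS' ⊢
      exact fun x hx => mem_known.1 hx S' hS'
    have h2 : cls S ^ n ≤ M ^ (n - (known f S).card) := by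
      refine (Nat.pow_le_pow_left h1 n).trans ?_
      rw [hM, hMcard, ← pow_mul, ← pow_mul, mul_comm b, mul_comm b, pow_mul, pow_mul]
      exact Nat.pow_le_pow_left (factorial_pow_le_factorial_pow (Nat.sub_le _ _)) b
    have hc : (0 : ℝ) < cls S := by exact_mod_cast hcls_pos S
    have h3 : (n : ℝ) * Real.log (cls S) ≤ (n - (known f S).card) * Real.log M := by
      have : (cls S : ℝ) ^ n ≤ (M : ℝ) ^ (n - (known f S).card) := by exact_mod_cast h2
      have := Real.log_le_log (by positivity) this
      rw [Real.log_pow, Real.log_pow, Nat.cast_sub hk] at this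
      exact this
    rw [← Real.le_log_iff_exp_le (by positivity), Real.log_div hMR.ne' hc.ne', div_mul_eq_mul_div,
      div_le_iff₀ hnR]
    linarith
  -- Each message class contributes 1 in total.
  have hclasses : ∑ S, (1 : ℝ) / cls S = (Finset.univ.image f).card := by
    rw [← Finset.sum_fiberwise_of_maps_to (s := Finset.univ) (t := Finset.univ.image f) (g := f)
      (fun S hS => Finset.mem_image_of_mem f hS), Finset.card_eq_sum_ones, Nat.cast_sum]
    refine Finset.sum_congr rfl fun m hm => ?_
    obtain ⟨S, -, rfl⟩ := Finset.mem_image.1 hm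
    have hc : (0 : ℝ) < cls S := by exact_mod_cast hcls_pos S
    rw [Finset.sum_congr rfl (g := fun _ => (1 : ℝ) / cls S) fun S' hS' => ?_]
    · rw [Finset.sum_const, nsmul_eq_mul, mul_one_div, Nat.cast_one]
      exact div_self hc.ne'
    · have : f S' = f S := (Finset.mem_filter.1 hS').2
      simp only [cls, this]
  -- Jensen passes from the average of M^(k/n), bounded by the number of messages, to the average of
  -- k.
  have hjensen := convexOn_exp.map_sum_le (t := Finset.univ) (w := fun _ => (1 : ℝ) / M)
    (p := fun S : Matching n (b + 1) => (known f S).card / n * Real.log M)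
    (fun _ _ => by positivity) (by simp [← hM, hMR.ne']) (fun _ _ => Set.mem_univ _)
  simp only [smul_eq_mul, ← Finset.mul_sum] at hjensen
  have hle : Real.exp (1 / M * ∑ S : Matching n (b + 1), (known f S).card / n * Real.log M) ≤
      (Finset.univ.image f).card := by
    refine hjensen.trans ?_
    rw [← hclasses, Finset.mul_sum]
    refine Finset.sum_le_sum fun S _ => ?_
    refine (mul_le_mul_of_nonneg_left (hkey S) (by positivity)).trans_eq ?_
    field_simp
  have himg : (0 : ℝ) < (Finset.univ.image f).card := by
    exact_mod_cast Finset.card_pos.2 (Finset.univ_nonempty.image f)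
  rw [← Real.le_log_iff_exp_le himg, ← Finset.sum_mul, ← Finset.sum_div, one_div,
    inv_mul_le_iff₀ hMR, div_mul_eq_mul_div, div_le_iff₀ hnR, hlogM] at hle
  linarith

end Matchings

/-- A finite set of bit strings of length at most `L` has at most `2 ^ (2 * L)` elements. -/
lemma card_bitStrings_le (L : ℕ) (T : Finset (List Bool)) (hT : ∀ s ∈ T, s.length ≤ L) :
    T.card ≤ 2 ^ (2 * L) := by
  have main : ∀ L : ℕ, ∃ U : Finset (List Bool), (∀ s, s.length ≤ L → s ∈ U) ∧
      -- The summand 1 makes the recursion |U'| ≤ 2|U| + 1 close up.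
      U.card + 1 ≤ 2 ^ (L + 1) := by
    intro L
    induction L with
    | zero => exact ⟨{[]}, fun s hs => by simpa using hs, by simp⟩
    | succ L ih =>
      obtain ⟨U, hU, hc⟩ := ih
      refine ⟨insert [] (U.image (List.cons true) ∪ U.image (List.cons false)), ?_, ?_⟩
      · intro s hs
        match s with
        | [] => simp
        | true :: s => simpa using hU s (by simpa using hs)
        | false :: s => simpa using hU s (by simpa using hs)
      · have h1 := Finset.card_insert_le ([] : List Bool)
          (U.image (List.cons true) ∪ U.image (List.cons false))
        have h2 := Finset.card_union_le (U.image (List.cons true)) (U.image (List.cons false))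
        have h3 := Finset.card_image_le (s := U) (f := List.cons true)
        have h4 := Finset.card_image_le (s := U) (f := List.cons false)
        rw [pow_succ]
        omega
  obtain ⟨U, hU, hc⟩ := main L
  have h1 : T.card ≤ U.card := Finset.card_le_card fun s hs => hU s (hT s hs)
  -- The exponent `2 * L` rather than `L + 1` keeps the logarithm linear in `L`, with no additive
  -- constant: zero bits carry no information.
  cases L with
  | zero => simp at hc ⊢; omega
  | succ L =>
    have : 2 ^ (L + 1 + 1) ≤ 2 ^ (2 * (L + 1)) := Nat.pow_le_pow_right (by norm_num) (by omega)
    omega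

end MPC

namespace MPC

/-! ### Densities of known tuples -/

section Density

variable {n a : ℕ}

lemma card_matching_pos (ha : 1 ≤ a) : 0 < Fintype.card (Matching n a) := by
  obtain ⟨b, rfl⟩ := Nat.exists_eq_add_of_le' ha
  rw [card_matching]
  positivity

lemma card_matching_mem_eq (hn : 0 < n) (ha : 1 ≤ a) (x : Fin a → Fin n) :
    ((Finset.univ.filter fun S : Matching n a => x ∈ S.1).card : ℝ) =
      Fintype.card (Matching n a) * n / (n : ℝ) ^ a := by
  obtain ⟨b, rfl⟩ := Nat.exists_eq_add_of_le' ha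
  have hnR : (n : ℝ) ≠ 0 := by exact_mod_cast hn.ne'
  rw [← card_matching_mem x, eq_div_iff (pow_ne_zero _ hnR)]
  push_cast
  ring

/-- The probability that the tuple `x` is known, relative to the probability that it belongs to
the relation. -/
noncomputable def knownDensity {β : Type*} (f : Matching n a → β) (x : Fin a → Fin n) : ℝ :=
  ((Finset.univ.filter fun S => x ∈ known f S).card : ℝ) /
    (Fintype.card (Matching n a) * n / (n : ℝ) ^ a)

lemma knownDensity_nonneg {β : Type*} (f : Matching n a → β) (x : Fin a → Fin n) :
    0 ≤ knownDensity f x := by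
  unfold knownDensity; positivity

/-- Known tuples belong to the relation. This bound is what allows a density to be replaced by a
power with exponent at most 1. -/
lemma knownDensity_le_one {β : Type*} (hn : 0 < n) (ha : 1 ≤ a) (f : Matching n a → β)
    (x : Fin a → Fin n) : knownDensity f x ≤ 1 := by
  refine div_le_one_of_le₀ ?_ (by positivity)
  rw [← card_matching_mem_eq hn ha x, Nat.cast_le]
  exact Finset.card_le_card fun S hS => by
    simp only [Finset.mem_filter, Finset.mem_univ, true_and] at hS ⊢
    exact known_subset f S hS

/-- Messages of at most `B` bits make at most a fraction of order `B / ((a - 1) log n!)` of the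
tuples known. -/
lemma average_knownDensity_le (hn : 2 ≤ n) (ha : 2 ≤ a) (f : Matching n a → List Bool) (B : ℝ)
    (hB : ∀ S, ((f S).length : ℝ) ≤ B) :
    (∑ x, knownDensity f x) / (n : ℝ) ^ a ≤
      2 * B * Real.log 2 / (((a : ℝ) - 1) * Real.log n.factorial) := by
  classical
  have hnR : (0 : ℝ) < n := by exact_mod_cast (by omega : 0 < n)
  have hM := card_matching_pos (n := n) (a := a) (by omega)
  have hMR : (0 : ℝ) < Fintype.card (Matching n a) := by exact_mod_cast hM
  obtain ⟨S₀⟩ := Fintype.card_pos_iff.1 hM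
  have hB0 : 0 ≤ B := (Nat.cast_nonneg _).trans (hB S₀)
  have hlog : 0 < Real.log n.factorial := by
    refine Real.log_pos ?_
    have h2 : (2 : ℕ) ≤ n.factorial := hn.trans (Nat.self_le_factorial n)
    exact_mod_cast (by omega : 1 < n.factorial)
  have haR : (0 : ℝ) < (a : ℝ) - 1 := by
    have : (2 : ℝ) ≤ a := by exact_mod_cast ha
    linarith
  have hswap : ∑ x, ((Finset.univ.filter fun S => x ∈ known f S).card : ℝ) =
      ∑ S, ((known f S).card : ℝ) := by
    have := Finset.sum_card_bipartiteAbove_eq_sum_card_bipartiteBelow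
      (s := (Finset.univ : Finset (Fin a → Fin n))) (t := (Finset.univ : Finset (Matching n a)))
      (fun x S => x ∈ known f S)
    simp only [Finset.bipartiteAbove, Finset.bipartiteBelow, Finset.filter_mem_eq_inter,
      Finset.univ_inter] at this
    exact_mod_cast this
  have hlogimg : Real.log (Finset.univ.image f).card ≤ 2 * B * Real.log 2 := by
    have h1 := card_bitStrings_le ⌊B⌋₊ (Finset.univ.image f) (fun s hs => by
      obtain ⟨S, -, rfl⟩ := Finset.mem_image.1 hs
      exact Nat.le_floor (hB S))
    have h2 : (0 : ℝ) < (Finset.univ.image f).card := by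
      exact_mod_cast Finset.card_pos.2 ⟨f S₀, Finset.mem_image_of_mem f (Finset.mem_univ S₀)⟩
    have h3 : ((Finset.univ.image f).card : ℝ) ≤ 2 ^ (2 * ⌊B⌋₊) := by exact_mod_cast h1
    have h4 := Real.log_le_log h2 h3
    rw [Real.log_pow] at h4
    push_cast at h4
    refine h4.trans (mul_le_mul_of_nonneg_right ?_ (Real.log_pos one_lt_two).le)
    linarith [Nat.floor_le hB0]
  have hsum : (∑ S, ((known f S).card : ℝ)) * (((a : ℝ) - 1) * Real.log n.factorial) ≤
      n * Fintype.card (Matching n a) * (2 * B * Real.log 2) := by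
    refine le_trans ?_ (mul_le_mul_of_nonneg_left hlogimg (by positivity))
    obtain ⟨b, rfl⟩ := Nat.exists_eq_add_of_le' (by omega : 1 ≤ a)
    have := sum_card_known_mul_log_le (by omega) f
    push_cast
    rw [add_sub_cancel_right]
    exact this
  unfold knownDensity
  rw [← Finset.sum_div, hswap, le_div_iff₀ (by positivity)]
  have : (∑ S, ((known f S).card : ℝ)) / (Fintype.card (Matching n a) * n / (n : ℝ) ^ a) /
      (n : ℝ) ^ a = (∑ S, ((known f S).card : ℝ)) / (n * Fintype.card (Matching n a)) := by
    field_simp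
  rw [this, div_mul_eq_mul_div, div_le_iff₀ (by positivity)]
  linarith

end Density

/-! ### The expected output of one worker -/

section Counting

variable {q : ConjunctiveQuery} {n p : ℕ}

/-- Double counting: for fixed `x` the conditions concern different relations, so the count of
databases factors. This is the independence of the relations. -/
lemma sum_card_filter_forall (P : (Fin q.numVars → Fin n) → (j : Fin q.numAtoms) →
    Matching n (q.arity j) → Prop) [∀ x j S, Decidable (P x j S)] :
    ∑ I : MatchingDatabase q n,
        ((Finset.univ.filter fun x => ∀ j, P x j (I j)).card : ℝ) =
      ∑ x, ∏ j, ((Finset.univ.filter fun S => P x j S).card : ℝ) := by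
  have := Finset.sum_card_bipartiteAbove_eq_sum_card_bipartiteBelow
    (s := (Finset.univ : Finset (MatchingDatabase q n)))
    (t := (Finset.univ : Finset (Fin q.numVars → Fin n))) (fun I x => ∀ j, P x j (I j))
  simp only [Finset.bipartiteAbove, Finset.bipartiteBelow] at this
  rw [← Nat.cast_sum, this, Nat.cast_sum]
  refine Finset.sum_congr rfl fun x _ => ?_
  rw [← Nat.cast_prod, ← Fintype.card_piFinset]
  congr 2
  ext I
  simp

/-- The total number of answers over all matching databases. -/
lemma sum_card_answers (hn : 0 < n) (ha : ∀ j, 1 ≤ q.arity j) :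
    ∑ I : MatchingDatabase q n, ((answers q I).card : ℝ) =
      (n : ℝ) ^ q.numVars * ∏ j, ((Fintype.card (Matching n (q.arity j)) * n : ℝ) /
        (n : ℝ) ^ q.arity j) := by
  classical
  have h := sum_card_filter_forall (q := q) (n := n) fun x j S => (fun t => x (q.var j t)) ∈ S.1
  have h' : ∀ I : MatchingDatabase q n, answers q I =
      Finset.univ.filter fun x => ∀ j, (fun t => x (q.var j t)) ∈ (I j).1 := by
    intro I; ext x; simp [answers]
  simp_rw [h']
  rw [h, Finset.sum_congr rfl fun x _ => Finset.prod_congr rfl fun j _ =>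
    card_matching_mem_eq hn (ha j) fun t => x (q.var j t)]
  simp

/-- A sound worker reports only tuples all of whose projections it knows. -/
lemma OneRoundAlgorithm.IsSound.mem_known {A : OneRoundAlgorithm q n p} (hA : A.IsSound)
    {w : Fin p} {I : MatchingDatabase q n} {x : Fin q.numVars → Fin n}
    (hx : x ∈ A.output w (A.received w I)) (j : Fin q.numAtoms) :
    (fun t => x (q.var j t)) ∈ known (A.message j w) (I j) := by
  rw [MPC.mem_known]
  intro S hS
  -- Exchanging `S_j` for a matching with the same message is invisible to the worker, which
  -- therefore still reports `x`.
  have hrec : A.received w (Function.update I j S) = A.received w I := by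
    ext1 j'
    by_cases h : j' = j
    · subst h; simpa [received] using hS
    · simp [received, h]
  have hmem : x ∈ answers q (Function.update I j S) :=
    hA _ (Finset.mem_biUnion.2 ⟨w, Finset.mem_univ _, by rwa [hrec]⟩)
  have := (Finset.mem_filter.1 hmem).2 j
  simpa using this

/-- The total number of tuples reported by one worker, in terms of a fractional edge packing and
the number `B` of bits received. -/
lemma sum_card_output_le (hrep : q.NoRepeatedVariables) (ha : ∀ j, 2 ≤ q.arity j) (hn : 2 ≤ n)
    {A : OneRoundAlgorithm q n p} (hA : A.IsSound) (w : Fin p) (B : ℝ)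
    (hB : ∀ I, ((∑ j, (A.received w I j).length : ℕ) : ℝ) ≤ B)
    (u : Fin q.numAtoms → ℝ) (hu : ∀ j, 0 ≤ u j)
    (hpack : ∀ i, ∑ j with i ∈ q.atomVars j, u j ≤ 1) :
    ∑ I : MatchingDatabase q n, ((A.output w (A.received w I)).card : ℝ) ≤
      (∏ j, (2 * B * Real.log 2 / (((q.arity j : ℝ) - 1) * Real.log n.factorial)) ^ u j) *
        ∑ I : MatchingDatabase q n, ((answers q I).card : ℝ) := by
  classical
  have hn0 : 0 < n := by omega
  have hnR : (0 : ℝ) < n := by exact_mod_cast hn0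
  have ha1 : ∀ j, 1 ≤ q.arity j := fun j => one_le_two.trans (ha j)
  have : Nonempty (Fin n) := ⟨⟨0, hn0⟩⟩
  -- Any `S` extends to a database, so the total bound `B` also bounds each single message.
  have hlen : ∀ j S, ((A.message j w S).length : ℝ) ≤ B := by
    intro j S
    have hne : ∀ j, Nonempty (Matching n (q.arity j)) := fun j =>
      Fintype.card_pos_iff.1 (card_matching_pos (ha1 j))
    let I : MatchingDatabase q n := Function.update (fun j => (hne j).some) j S
    refine le_trans ?_ (hB I)
    rw [Nat.cast_le]
    have hI : (A.received w I j).length = (A.message j w S).length := by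
      simp [OneRoundAlgorithm.received, I]
    rw [← hI]
    exact Finset.single_le_sum (f := fun j => (A.received w I j).length)
      (fun _ _ => Nat.zero_le _) (Finset.mem_univ j)
  have hu1 : ∀ j, u j ≤ 1 := by
    intro j
    refine le_trans ?_ (hpack (q.var j ⟨0, ha1 j⟩))
    refine Finset.single_le_sum (f := u) (fun j _ => hu j) ?_
    simp [ConjunctiveQuery.atomVars]
  set W : Fin q.numAtoms → ℝ := fun j =>
    (Fintype.card (Matching n (q.arity j)) * n : ℝ) / (n : ℝ) ^ q.arity j with hW
  have hWpos : ∀ j, 0 < W j := by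
    intro j
    have : (0 : ℝ) < Fintype.card (Matching n (q.arity j)) := by
      exact_mod_cast card_matching_pos (ha1 j)
    simp only [hW]; positivity
  let g : Fin q.numAtoms → (Fin q.numVars → Fin n) → ℝ := fun j x =>
    knownDensity (A.message j w) fun t => x (q.var j t)
  have hg0 : ∀ j x, 0 ≤ g j x := fun j x => knownDensity_nonneg _ _
  have h1 : ∑ I : MatchingDatabase q n, ((A.output w (A.received w I)).card : ℝ) ≤
      ∑ x, ∏ j, (W j * g j x) := by
    have h := sum_card_filter_forall (q := q) (n := n)
      fun x j S => (fun t => x (q.var j t)) ∈ known (A.message j w) S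
    have hR : ∀ x j, W j * g j x = ((Finset.univ.filter fun S : Matching n (q.arity j) =>
        (fun t => x (q.var j t)) ∈ known (A.message j w) S).card : ℝ) := by
      intro x j
      simp only [g, knownDensity]
      rw [mul_div_cancel₀ _ (hWpos j).ne']
    simp_rw [hR]
    rw [← h]
    refine Finset.sum_le_sum fun I _ => Nat.cast_le.2 (Finset.card_le_card fun x hx => ?_)
    simp only [Finset.mem_filter, Finset.mem_univ, true_and]
    exact fun j => hA.mem_known hx j
  -- Densities and packing weights are at most 1, so `g ≤ g ^ u`; this introduces the exponents that
  -- Finner's inequality needs.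
  have h2 : ∑ x, ∏ j, (W j * g j x) ≤ (∏ j, W j) * ∑ x, ∏ j, g j x ^ u j := by
    rw [Finset.mul_sum]
    refine Finset.sum_le_sum fun x _ => ?_
    rw [Finset.prod_mul_distrib]
    refine mul_le_mul_of_nonneg_left (Finset.prod_le_prod (fun j _ => hg0 j x) fun j _ => ?_)
      (Finset.prod_nonneg fun j _ => (hWpos j).le)
    exact Real.self_le_rpow_of_le_one (hg0 j x) (knownDensity_le_one hn0 (ha1 j) _ _) (hu1 j)
  have h3 := finner u hu q.numVars q.atomVars g hg0 (fun j x y hxy => by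
    have : (fun t => x (q.var j t)) = fun t => y (q.var j t) := by
      ext1 t
      exact hxy _ (Finset.mem_image_of_mem _ (Finset.mem_univ t))
    simp only [g, this]) hpack
  have h4 : ∏ j, ((∑ x, g j x) / (Fintype.card (Fin n) : ℝ) ^ q.numVars) ^ u j ≤
      ∏ j, (2 * B * Real.log 2 / (((q.arity j : ℝ) - 1) * Real.log n.factorial)) ^ u j := by
    refine Finset.prod_le_prod (fun j _ => Real.rpow_nonneg (div_nonneg
      (Finset.sum_nonneg fun x _ => hg0 j x) (by positivity)) _) fun j _ => ?_
    refine Real.rpow_le_rpow (div_nonneg (Finset.sum_nonneg fun x _ => hg0 j x)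
      (by positivity)) ?_ (hu j)
    simp only [g]
    rw [average_comp_injective (q.var j) (hrep j) (knownDensity (A.message j w)),
      Fintype.card_fin]
    exact average_knownDensity_le hn (ha j) _ B (hlen j)
  have h5 := h3.trans h4
  rw [Fintype.card_fin, div_le_iff₀ (by positivity)] at h5
  refine h1.trans (h2.trans ?_)
  rw [sum_card_answers hn0 ha1]
  refine (mul_le_mul_of_nonneg_left h5 (Finset.prod_nonneg fun j _ => (hWpos j).le)).trans_eq ?_
  ring

end Counting

end MPC

/-! ### The bound for all workers -/

theorem theorem3p3 (q : MPC.ConjunctiveQuery) (hconn : q.IsConnected)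
    (hrep : q.NoRepeatedVariables) (harity : ∀ j, 2 ≤ q.arity j) (c : ℝ) (hc : 0 < c) :
    ∃ C : ℝ, 0 < C ∧
      ∀ ε : ℝ, 0 ≤ ε → ε < 1 - 1 / q.tauStar →
      ∀ n p : ℕ, 2 ≤ n → 1 ≤ p →
      ∀ A : MPC.OneRoundAlgorithm q n p, A.ObeysMPC c ε → A.IsSound →
        MPC.expectation q n (fun I => ((A.reported I).card : ℝ)) ≤
          C * (MPC.expectation q n (fun I => ((MPC.answers q I).card : ℝ)) /
            (p : ℝ) ^ (q.tauStar * (1 - ε) - 1)) := by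
  classical
  have hne : Nonempty (Fin q.numAtoms) := by
    obtain ⟨i⟩ := hconn.nonempty
    obtain ⟨j, -⟩ := q.occurs i
    exact ⟨j⟩
  have hτ : 0 < q.tauStar := zero_lt_one.trans_le
    (MPC.one_le_tauStar q fun j => one_le_two.trans (harity j))
  obtain ⟨u, hu, hpack, husum⟩ := MPC.exists_edgePacking q hτ
  have haR : ∀ j, (1 : ℝ) ≤ (q.arity j : ℝ) - 1 := by
    intro j
    have : (2 : ℝ) ≤ q.arity j := by exact_mod_cast harity j
    linarith
  set E : ℝ := ∑ j, ((q.arity j : ℝ) - 1) with hE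
  have hEpos : 0 < E := Finset.sum_pos (fun j _ => zero_lt_one.trans_le (haR j))
    Finset.univ_nonempty
  -- Here `E * logb 2 n!` is the input size, and the factor 2 comes from counting bit strings.
  refine ⟨(2 * c * E) ^ q.tauStar, by positivity, ?_⟩
  intro ε _ _ n p hn hp A hobey hsound
  have hpR : (0 : ℝ) < p := by exact_mod_cast hp
  set P : ℝ := (p : ℝ) ^ (1 - ε) with hP
  have hPpos : 0 < P := Real.rpow_pos_of_pos hpR _
  have hlog : 0 < Real.log n.factorial := by
    refine Real.log_pos ?_
    have h2 : (2 : ℕ) ≤ n.factorial := hn.trans (Nat.self_le_factorial n)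
    exact_mod_cast (by omega : 1 < n.factorial)
  have hlog2 : 0 < Real.log 2 := Real.log_pos one_lt_two
  set B : ℝ := c * MPC.inputBits q n / P with hBdef
  have hB : 2 * B * Real.log 2 = 2 * c * E / P * Real.log n.factorial := by
    rw [hBdef, MPC.inputBits, ← Finset.sum_mul, ← hE, Real.logb]
    field_simp
  have hworker : ∀ w : Fin p,
      ∑ I : MPC.MatchingDatabase q n, ((A.output w (A.received w I)).card : ℝ) ≤
        (2 * c * E / P) ^ q.tauStar *
          ∑ I : MPC.MatchingDatabase q n, ((MPC.answers q I).card : ℝ) := by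
    intro w
    refine (MPC.sum_card_output_le hrep harity hn hsound w B (fun I => hobey I w) u hu
      hpack).trans ?_
    refine mul_le_mul_of_nonneg_right ?_ (Finset.sum_nonneg fun _ _ => Nat.cast_nonneg _)
    rw [← husum, Real.rpow_sum_of_pos (by positivity)]
    have hD : ∀ j, 2 * B * Real.log 2 / (((q.arity j : ℝ) - 1) * Real.log n.factorial) =
        2 * c * E / P / ((q.arity j : ℝ) - 1) := by
      intro j
      have := haR j
      rw [hB, mul_div_mul_right _ _ hlog.ne']
    -- The denominators `a_j - 1` are at least 1 and can be dropped, leaving a common base whose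
    -- exponents sum to τ*.
    refine Finset.prod_le_prod (fun j _ => ?_) fun j _ => ?_
    · rw [hD]
      have := haR j
      exact Real.rpow_nonneg (div_nonneg (by positivity) (by linarith)) _
    · rw [hD]
      have := haR j
      exact Real.rpow_le_rpow (div_nonneg (by positivity) (by linarith))
        (div_le_self (by positivity) this) (hu j)
  have htotal : ∑ I : MPC.MatchingDatabase q n, ((A.reported I).card : ℝ) ≤
      p * ((2 * c * E / P) ^ q.tauStar *
        ∑ I : MPC.MatchingDatabase q n, ((MPC.answers q I).card : ℝ)) := by
    calc ∑ I : MPC.MatchingDatabase q n, ((A.reported I).card : ℝ)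
        ≤ ∑ I : MPC.MatchingDatabase q n, ∑ w, ((A.output w (A.received w I)).card : ℝ) :=
          Finset.sum_le_sum fun I _ => by exact_mod_cast Finset.card_biUnion_le
      _ = ∑ w, ∑ I : MPC.MatchingDatabase q n, ((A.output w (A.received w I)).card : ℝ) :=
          Finset.sum_comm
      _ ≤ ∑ _w : Fin p, (2 * c * E / P) ^ q.tauStar *
            ∑ I : MPC.MatchingDatabase q n, ((MPC.answers q I).card : ℝ) :=
          Finset.sum_le_sum fun w _ => hworker w
      _ = _ := by simp
  -- Summing over workers costs one factor `p`, which is the `-1` in the exponent.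
  have hexp : (p : ℝ) * (2 * c * E / P) ^ q.tauStar =
      (2 * c * E) ^ q.tauStar / (p : ℝ) ^ (q.tauStar * (1 - ε) - 1) := by
    rw [Real.div_rpow (by positivity) hPpos.le, hP, ← Real.rpow_mul hpR.le,
      Real.rpow_sub_one hpR.ne', mul_comm (1 - ε)]
    field_simp
  unfold MPC.expectation
  rw [div_div, mul_comm _ ((p : ℝ) ^ _), ← div_div, ← mul_div_assoc]
  refine div_le_div_of_nonneg_right (htotal.trans_eq ?_) (Nat.cast_nonneg _)
  rw [← mul_assoc, hexp]
  ring
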